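/- Let $\mathbb D$ be the open unit disc and $\mathbb T$ the unit circle. Let $b$ be a rational function in the closed unit ball of $H^\infty$ with $\|b\|_\infty=1$ that is not inner (not a finite Blaschke product), and let $\mathscr H(b)$ be the de Branges–Rovnyak space of $b$, i.e. the space of all $f\in H^2$ with $\|f\|_{\mathscr H(b)}^2:=\sup_{g\in H^2}\left(\|f+bg\|_2^2-\|g\|_2^2\right)<\infty$. Let $\tilde a$ be the Pythagorean mate of $b$, i.e. the unique rational function without poles in $\overline{\mathbb D}$ and without zeros in $\mathbb D$ such that $|\tilde a|^2+|b|^2=1$ on $\mathbb T$ and $\tilde a(0)>0$. Let $\zeta_1,\dots,\zeta_n$ be the distinct zeros of $\tilde a$ on $\mathbb T$, with multiplicities $m_1,\dots,m_n$, and let $a(z)=\prod_{i=1}^n(z-\zeta_i)^{m_i}$, so that its zero set is $Z(a)=\{\zeta_1,\dots,\zeta_n\}$. Let $u:\mathbb D\to\mathbb C$ and $\varphi:\mathbb D\to\mathbb D$ be analytic, and assume that the weighted composition operator $W_{u,\varphi}:f\mapsto u\cdot (f\circ\varphi)$ is bounded from $\mathscr H(b)$ into itself. Then, for every $1\le i\le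 n$, the derivatives $u^{(\ell)}$, $0\le \ell\le m_i-1$, have non-tangential limits $u^{(\ell)}(\zeta_i)$ at $\zeta_i$, and the following condition (NC) holds: either $u^{(\ell)}(\zeta_i)=0$ for all $0\le\ell\le m_i-1$, or $\varphi$ has a non-tangential limit $\varphi(\zeta_i)$ at $\zeta_i$, and $\varphi(\zeta_i)\in\mathbb D\cup Z(a)$. -/

import Mathlib

namespace DBR

/-- The open unit disc. -/
def disc : Set ℂ := Metric.ball 0 1

/-- The `n`-th Taylor coefficient of `f` at the origin. -/
noncomputable def taylorCoeff (f : ℂ → ℂ) (n : ℕ) : ℂ :=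
  iteratedDeriv n f 0 / (n.factorial : ℂ)

/-- The Hardy space `H²` of the unit disc: analytic functions with square-summable Taylor
coefficients. Functions are total on `ℂ`, only their restriction to the disc matters. -/
def hardyTwo : Set (ℂ → ℂ) :=
  {f | DifferentiableOn ℂ f disc ∧ Summable fun n => ‖taylorCoeff f n‖ ^ 2}

/-- The square of the `H²`-norm. -/
noncomputable def hardyNormSq (f : ℂ → ℂ) : ℝ := ∑' n, ‖taylorCoeff f n‖ ^ 2

/-- The value of a rational function at a point. -/
noncomputable def val (r : RatFunc ℂ) (z : ℂ) : ℂ := r.eval (RingHom.id ℂ) z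

/-- The rational function `r` has no poles in the closed unit disc; for a rational function
this says exactly that it belongs to `H^∞`. (Numerator and denominator are coprime.) -/
def NoPoles (r : RatFunc ℂ) : Prop := ∀ z : ℂ, ‖z‖ ≤ 1 → r.denom.eval z ≠ 0

/-- Rational functions `b` in the closed unit ball of `H^∞` with `‖b‖_∞ = 1` which are not
inner, i.e. not finite Blaschke products (nor unimodular constants). -/
structure IsSymbol (b : RatFunc ℂ) : Prop where
  noPoles : NoPoles b
  norm_eq_one : IsLUB ((fun z => ‖val b z‖) '' disc) 1
  not_inner : ¬ ∀ z : ℂ, ‖z‖ = 1 → ‖val b z‖ = 1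

/-- `a` is the Pythagorean mate of the rational function `b`. For a rational function without
poles in the closed disc, being outer means having no zeros in the open disc. These conditions
determine `a` uniquely. -/
structure IsPythagoreanMate (b a : RatFunc ℂ) : Prop where
  noPoles : NoPoles a
  outer : ∀ z ∈ disc, val a z ≠ 0
  re_pos : 0 < (val a 0).re
  im_zero : (val a 0).im = 0
  sq_add_sq : ∀ z : ℂ, ‖z‖ = 1 → ‖val a z‖ ^ 2 + ‖val b z‖ ^ 2 = 1

/-- The zeros of a rational function on the unit circle. -/
def circleZeros (a : RatFunc ℂ) : Set ℂ := {z | ‖z‖ = 1 ∧ val a z = 0}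

/-- The multiplicity of `z` as a zero of a rational function (for `z` not a pole). -/
noncomputable def zeroMult (a : RatFunc ℂ) (z : ℂ) : ℕ := a.num.rootMultiplicity z

/-- The numbers `‖f + b g‖² - ‖g‖²`, where `g` runs through `H²`. -/
def dbrValues (b : RatFunc ℂ) (f : ℂ → ℂ) : Set ℝ :=
  {s | ∃ g ∈ hardyTwo, s = hardyNormSq (fun z => f z + val b z * g z) - hardyNormSq g}

/-- The de Branges–Rovnyak space `H(b)`, in the original definition of de Branges and Rovnyak:
all `f ∈ H²` with `sup {‖f + b g‖² - ‖g‖² : g ∈ H²} < ∞`. -/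
def dbrSpace (b : RatFunc ℂ) : Set (ℂ → ℂ) :=
  {f | f ∈ hardyTwo ∧ BddAbove (dbrValues b f)}

/-- The norm of `H(b)`: its square is the above supremum. -/
noncomputable def dbrNorm (b : RatFunc ℂ) (f : ℂ → ℂ) : ℝ := √(sSup (dbrValues b f))

/-- The weighted composition operator `W_{u,φ} f = u · (f ∘ φ)`. -/
def weightedComp (u φ f : ℂ → ℂ) : ℂ → ℂ := fun z => u z * f (φ z)

/-- `W_{u,φ}` is a bounded operator from `H(b)` into itself. -/
def IsBoundedWComp (b : RatFunc ℂ) (u φ : ℂ → ℂ) : Prop :=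
  ∃ C : ℝ, ∀ f ∈ dbrSpace b,
    weightedComp u φ f ∈ dbrSpace b ∧ dbrNorm b (weightedComp u φ f) ≤ C * dbrNorm b f

/-- The Stolz region with vertex `ζ` and aperture `α`. -/
def stolz (ζ : ℂ) (α : ℝ) : Set ℂ := {z | ‖z‖ < 1 ∧ ‖z - ζ‖ < α * (1 - ‖z‖)}

/-- `f` has the non-tangential limit `w` at the point `ζ` of the unit circle. -/
def HasNTLimit (f : ℂ → ℂ) (ζ w : ℂ) : Prop :=
  ∀ α : ℝ, 1 < α → Filter.Tendsto f (nhdsWithin ζ (stolz ζ α)) (nhds w)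

end DBR

/-! Write `S` for the shift on `ℓ²`, the coefficient model of `H²`, and `p` for the numerator of
`a`. Everything rests on the description `H(b) = p(S)† H²` (`mem_dbrSpace_iff`). Multiplication by
`a` and by `b` gives `A†A + B†B = 1`, so finiteness of the supremum means, by Douglas' lemma, that
`B† f` lies in the range of `A†`. A Bézout identity between the two numerators then puts `f` itself
in the range of `p(S)†`.

At a zero `ζ` of `a` of multiplicity `m`, every `f` in `H(b)` is therefore a polynomial plus `(z -
ζ)^m h` with `h ∈ H²` (`exists_local_form`). For `u = W 1` this gives the limits of the derivatives
of order below `m`. If they do not all vanish, `u / (z - ζ)^k` has a nonzero limit for some `k < m`.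

The quotient by `(z - ζ)^k` of any function of this local form either converges or is at least of
order `|z - ζ|⁻¹` (`hasNTLimit_div_pow_or`). For `u φ = W z` blow-up is impossible because `φ` is
bounded, so `φ` has a limit `w`. If `w` were on the circle outside `Z(a)`, take `f ∈ H(b)` tending
to `∞` at `w`. Then `u (f ∘ φ) / (z - ζ)^k` does not converge, while the growth of `H²` functions
and Schwarz–Pick bound it by a multiple of `|z - ζ|^(-1/2)`: a contradiction. -/

namespace DBR

/-! ### Polynomials in the shift on `ℓ²` -/

open Polynomial ContinuousLinearMap
open scoped ComplexConjugate InnerProductSpace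

/-- The sequence space `ℓ²`, the coefficient model of `H²`. -/
abbrev EllTwo : Type := lp (fun _ : ℕ => ℂ) 2

theorem memLp_two_iff {c : ℕ → ℂ} : Memℓp c 2 ↔ Summable fun n => ‖c n‖ ^ 2 := by
  rw [memℓp_gen_iff (by norm_num)]
  norm_num

theorem EllTwo.summable_sq (c : EllTwo) : Summable fun n => ‖c n‖ ^ 2 :=
  memLp_two_iff.1 (lp.memℓp c)

theorem EllTwo.norm_sq (c : EllTwo) : ‖c‖ ^ 2 = ∑' n, ‖c n‖ ^ 2 := by
  have := lp.norm_rpow_eq_tsum (p := 2) (by norm_num) c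
  norm_num at this
  exact this

/-- The sequence `0, c 0, c 1, …`. -/
def shiftFun (c : ℕ → ℂ) : ℕ → ℂ
  | 0 => 0
  | n + 1 => c n

theorem memLp_shiftFun (c : EllTwo) : Memℓp (shiftFun c) 2 :=
  memLp_two_iff.2 ((summable_nat_add_iff 1).1 c.summable_sq)

/-- The forward shift on `ℓ²` as a linear isometry. -/
noncomputable def shiftIsometry : EllTwo →ₗᵢ[ℂ] EllTwo where
  toFun c := ⟨shiftFun c, memLp_shiftFun c⟩
  map_add' c d := by
    ext n
    cases n with
    | zero => exact (add_zero (0 : ℂ)).symm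
    | succ n => rfl
  map_smul' k c := by
    ext n
    cases n <;> simp [shiftFun]
  norm_map' c := by
    have : ‖(⟨shiftFun c, memLp_shiftFun c⟩ : EllTwo)‖ ^ 2 = ‖c‖ ^ 2 := by
      rw [EllTwo.norm_sq, EllTwo.norm_sq, (EllTwo.summable_sq _).tsum_eq_zero_add]
      simp [shiftFun]
    exact (sq_eq_sq₀ (norm_nonneg _) (norm_nonneg _)).1 this

/-- The forward shift on `ℓ²`. -/
noncomputable def shift : EllTwo →L[ℂ] EllTwo := shiftIsometry.toContinuousLinearMap

@[simp] theorem shift_zero (c : EllTwo) : shift c 0 = 0 := rfl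

@[simp] theorem shift_succ (c : EllTwo) (n : ℕ) : shift c (n + 1) = c n := rfl

theorem norm_shift_apply (c : EllTwo) : ‖shift c‖ = ‖c‖ := shiftIsometry.norm_map c

theorem adjoint_shift_mul_shift : adjoint shift * shift = 1 :=
  (ContinuousLinearMap.norm_map_iff_adjoint_comp_self shift).1 norm_shift_apply

theorem shift_single (n : ℕ) : shift (lp.single 2 n 1) = lp.single 2 (n + 1) 1 := by
  ext k
  cases k with
  | zero => simp
  | succ k => simp [Pi.single_apply]

@[simp] theorem adjoint_shift_apply (c : EllTwo) (n : ℕ) : adjoint shift c n = c (n + 1) := by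
  have h := ContinuousLinearMap.adjoint_inner_right shift (lp.single 2 n 1) c
  rw [shift_single, lp.inner_single_left, lp.inner_single_left] at h
  simpa using h

theorem norm_shift_le_one : ‖shift‖ ≤ 1 :=
  shiftIsometry.norm_toContinuousLinearMap_le

/-- The operator of multiplication by a polynomial. -/
noncomputable def polyOp (p : ℂ[X]) : EllTwo →L[ℂ] EllTwo := aeval shift p

theorem polyOp_mul (p q : ℂ[X]) : polyOp (p * q) = polyOp p * polyOp q := map_mul _ _ _

theorem polyOp_add (p q : ℂ[X]) : polyOp (p + q) = polyOp p + polyOp q := map_add _ _ _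

theorem polyOp_commute (p q : ℂ[X]) : Commute (polyOp p) (polyOp q) := by
  rw [Commute, SemiconjBy, ← polyOp_mul, ← polyOp_mul, mul_comm]

instance : Nontrivial EllTwo :=
  ⟨lp.single 2 0 1, 0, fun h => by
    have := congrArg (fun c : EllTwo => c 0) h
    simp at this⟩

/-- Spectral mapping: the spectrum of the shift lies in the closed disc, where `p` has no zero. -/
theorem isUnit_polyOp {p : ℂ[X]} (hp : ∀ z : ℂ, ‖z‖ ≤ 1 → p.eval z ≠ 0) : IsUnit (polyOp p) := by
  rw [← spectrum.zero_notMem_iff ℂ, polyOp, spectrum.map_polynomial_aeval]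
  rintro ⟨z, hz, h⟩
  refine hp z ?_ h
  have := spectrum.subset_closedBall_norm shift hz
  rw [mem_closedBall_zero_iff] at this
  exact this.trans norm_shift_le_one

theorem shift_pow_adjoint_mul (n : ℕ) : adjoint (shift ^ n) * shift ^ n = 1 := by
  induction n with
  | zero =>
    rw [pow_zero, ← star_eq_adjoint]; simp
  | succ n ih =>
    rw [← star_eq_adjoint] at *
    calc star (shift ^ (n + 1)) * shift ^ (n + 1)
        = star (shift ^ n) * (star shift * shift) * shift ^ n := by
          rw [pow_succ', star_mul]; simp only [mul_assoc]
      _ = 1 := by rw [star_eq_adjoint shift, adjoint_shift_mul_shift, mul_one, ih]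

/-- The polynomial `z ^ N * conj (p (1 / conj z))`. -/
noncomputable def conjReflect (N : ℕ) (p : ℂ[X]) : ℂ[X] := reflect N (p.map (starRingEnd ℂ))

/-- Since the shift is an isometry, `(S†)^n S^N = S^(N - n)` for `n ≤ N`; the rest is conjugate
linearity in `p`. -/
theorem star_polyOp_mul_shift_pow {N : ℕ} {p : ℂ[X]} (hp : p.natDegree ≤ N) :
    adjoint (polyOp p) * shift ^ N = polyOp (conjReflect N p) := by
  refine Polynomial.induction_with_natDegree_le
    (fun p => adjoint (polyOp p) * shift ^ N = polyOp (conjReflect N p)) N ?_ ?_ ?_ p hp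
  · simp [polyOp, conjReflect]
  · intro n r _ hn
    obtain ⟨k, rfl⟩ := Nat.exists_eq_add_of_le hn
    have h1 : polyOp (C r * X ^ n) = r • shift ^ n := by
      simp [polyOp, Algebra.smul_def]
    have h2 : polyOp (conjReflect (n + k) (C r * X ^ n)) = conj r • shift ^ k := by
      simp [polyOp, conjReflect, Algebra.smul_def, revAt_le]
    rw [h1, h2, ← star_eq_adjoint, star_smul, pow_add, smul_mul_assoc, ← mul_assoc,
      star_eq_adjoint, shift_pow_adjoint_mul, one_mul]
    rfl
  · intro f g _ _ hf hg
    have : conjReflect N (f + g) = conjReflect N f + conjReflect N g := by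
      simp [conjReflect, reflect_add]
    rw [this, polyOp_add, polyOp_add, map_add, add_mul, hf, hg]

theorem conjReflect_eval {N : ℕ} {p : ℂ[X]} (hp : p.natDegree ≤ N) {z : ℂ} (hz : ‖z‖ = 1) :
    (conjReflect N p).eval z = z ^ N * conj (p.eval z) := by
  have hz0 : z ≠ 0 := by
    rintro rfl
    simp at hz
  have hc : z * conj z = 1 := by
    rw [Complex.mul_conj, Complex.normSq_eq_norm_sq, hz]; simp
  have hc' : conj z * z = 1 := by rw [mul_comm, hc]
  let _ : Invertible (conj z) := ⟨z, hc, hc'⟩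
  have h := eval₂_reflect_mul_pow (RingHom.id ℂ) (conj z) N (p.map (starRingEnd ℂ))
    (by rwa [natDegree_map])
  have h' : (conjReflect N p).eval z * conj z ^ N = conj (p.eval z) := by
    have h3 : (p.map (starRingEnd ℂ)).eval (conj z) = conj (p.eval z) := by
      rw [eval_map, eval₂_at_apply]
    rw [← h3]
    exact h
  rw [← h', mul_comm, mul_assoc, ← mul_pow, hc', one_pow, mul_one]

theorem inner_polyOp_self {N : ℕ} {p : ℂ[X]} (hp : p.natDegree ≤ N) (x : EllTwo) :
    ⟪polyOp p x, polyOp p x⟫_ℂ = ⟪(shift ^ N) x, polyOp (conjReflect N p * p) x⟫_ℂ := by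
  have h1 : polyOp (conjReflect N p * p) x
      = adjoint (polyOp p) (polyOp p ((shift ^ N) x)) := by
    have hs : polyOp (X ^ N) = shift ^ N := by simp [polyOp]
    rw [polyOp_mul, ← star_polyOp_mul_shift_pow hp, mul_assoc, ← hs, (polyOp_commute _ _).eq]
    rfl
  have h2 : polyOp p ((shift ^ N) x) = (shift ^ N) (polyOp p x) := by
    have hs : polyOp (X ^ N) = shift ^ N := by simp [polyOp]
    have := (polyOp_commute p (X ^ N)).eq
    rw [hs] at this
    exact DFunLike.congr_fun this x
  have h3 : adjoint (shift ^ N) ((shift ^ N) (polyOp p x)) = polyOp p x :=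
    DFunLike.congr_fun (shift_pow_adjoint_mul N) (polyOp p x)
  rw [h1, adjoint_inner_right, h2, ← adjoint_inner_right (shift ^ N), h3]

theorem infinite_circle : {z : ℂ | ‖z‖ = 1}.Infinite := by
  have h : {z : ℂ | ‖z‖ = 1} = Metric.sphere (0 : ℂ) 1 := by ext; simp
  rw [h]
  exact (IsConnected.isPreconnected
    (isConnected_sphere (by simp) 0 zero_le_one)).infinite_of_nontrivial
      ⟨1, by simp, -1, by simp, by norm_num⟩

/-- The identity on the circle becomes, after multiplication by `z^N`, an identity of polynomials at
infinitely many points. It can then be evaluated at the shift. -/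
theorem norm_polyOp_sq_add_sq {p q r : ℂ[X]}
    (h : ∀ z : ℂ, ‖z‖ = 1 → ‖p.eval z‖ ^ 2 + ‖q.eval z‖ ^ 2 = ‖r.eval z‖ ^ 2) (x : EllTwo) :
    ‖polyOp p x‖ ^ 2 + ‖polyOp q x‖ ^ 2 = ‖polyOp r x‖ ^ 2 := by
  set N := max p.natDegree (max q.natDegree r.natDegree)
  have hp : p.natDegree ≤ N := by simp [N]
  have hq : q.natDegree ≤ N := by simp [N]
  have hr : r.natDegree ≤ N := by simp [N]
  have key : conjReflect N p * p + conjReflect N q * q = conjReflect N r * r := by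
    refine Polynomial.eq_of_infinite_eval_eq _ _ (infinite_circle.mono fun z (hz : ‖z‖ = 1) => ?_)
    have e : ∀ w : ℂ, conj w * w = ((‖w‖ ^ 2 : ℝ) : ℂ) := fun w => by
      rw [mul_comm, Complex.mul_conj, Complex.normSq_eq_norm_sq]
    simp only [Set.mem_ofPred_eq, eval_add, eval_mul, conjReflect_eval hp hz,
      conjReflect_eval hq hz, conjReflect_eval hr hz, mul_assoc, e]
    rw [← h z hz]
    push_cast
    ring
  have e : ⟪polyOp p x, polyOp p x⟫_ℂ + ⟪polyOp q x, polyOp q x⟫_ℂ = ⟪polyOp r x, polyOp r x⟫_ℂ := by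
    rw [inner_polyOp_self hp, inner_polyOp_self hq, inner_polyOp_self hr, ← inner_add_right, ← key,
      polyOp_add]
    rfl
  simp only [inner_self_eq_norm_sq_to_K] at e
  exact_mod_cast e

end DBR

/-! ### Douglas' lemma and the supremum defining the space -/

namespace DBR

open ContinuousLinearMap
open scoped InnerProductSpace

/-- Douglas' lemma for vectors: a functional dominated by `A` lies in the range of `A†`. -/
theorem mem_range_adjoint_of_bound {H : Type*} [NormedAddCommGroup H] [InnerProductSpace ℂ H] 
    [CompleteSpace H] (A : H →L[ℂ] H) (x : H) (C : ℝ)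
    (h : ∀ g, ‖⟪x, g⟫_ℂ‖ ≤ C * ‖A g‖) : ∃ y, x = adjoint A y := by
  let l : H →ₗ[ℂ] ℂ := (innerSL ℂ x).toLinearMap
  have hl : ∀ g, l g = ⟪x, g⟫_ℂ := fun g => rfl
  let A' : H →ₗ[ℂ] H := A.toLinearMap
  have hker : LinearMap.ker A' ≤ LinearMap.ker l := by
    intro g hg
    have h0 : A g = 0 := hg
    have := h g
    rw [h0, norm_zero, mul_zero] at this
    exact norm_le_zero_iff.1 this
  -- The bound makes `A g ↦ ⟪x, g⟫` well defined and bounded on the range of `A`; Hahn–Banach and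
  -- Riesz then produce `y`.
  let m : LinearMap.range A' →ₗ[ℂ] ℂ :=
    ((LinearMap.ker A').liftQ l hker).comp A'.quotKerEquivRange.symm.toLinearMap
  have hm : ∀ g, m ⟨A' g, LinearMap.mem_range_self A' g⟩ = ⟪x, g⟫_ℂ := by
    intro g
    simp only [m, LinearMap.comp_apply, LinearEquiv.coe_coe]
    rw [LinearMap.quotKerEquivRange_symm_apply_image, Submodule.mkQ_apply, Submodule.liftQ_apply, hl]
  let M : StrongDual ℂ (LinearMap.range A') := m.mkContinuous C (by
    rintro ⟨_, g, rfl⟩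
    rw [hm]
    exact h g)
  obtain ⟨G, hG, -⟩ := exists_extension_norm_eq (LinearMap.range A') M
  refine ⟨(InnerProductSpace.toDual ℂ H).symm G, ext_inner_right ℂ fun g => ?_⟩
  rw [adjoint_inner_left, InnerProductSpace.toDual_symm_apply, ← hm g]
  exact (hG ⟨A' g, LinearMap.mem_range_self A' g⟩).symm

theorem norm_add_sq_sub_norm_sq {H : Type*} [NormedAddCommGroup H] [InnerProductSpace ℂ H] 
    {A B : H →L[ℂ] H}
    (hAB : ∀ g, ‖A g‖ ^ 2 + ‖B g‖ ^ 2 = ‖g‖ ^ 2) (x g : H) :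
    ‖x + B g‖ ^ 2 - ‖g‖ ^ 2 = ‖x‖ ^ 2 + 2 * (⟪x, B g⟫_ℂ).re - ‖A g‖ ^ 2 := by
  have := @norm_add_sq ℂ H _ _ _ x (B g)
  rw [this, ← hAB g]
  simp only [RCLike.re_to_complex]
  ring

/-- Commutation turns the linear term into `⟪y, B (A g)⟫`, at most `‖y‖ ‖A g‖`, which the term `-‖A
g‖²` absorbs. -/
theorem bddAbove_of_mem_range_adjoint {H : Type*} [NormedAddCommGroup H] [InnerProductSpace ℂ H] 
    [CompleteSpace H] {A B : H →L[ℂ] H}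
    (hAB : ∀ g, ‖A g‖ ^ 2 + ‖B g‖ ^ 2 = ‖g‖ ^ 2) (hc : Commute A B) (y : H) :
    BddAbove (Set.range fun g => ‖adjoint A y + B g‖ ^ 2 - ‖g‖ ^ 2) := by
  refine ⟨‖adjoint A y‖ ^ 2 + ‖y‖ ^ 2, ?_⟩
  rintro _ ⟨g, rfl⟩
  simp only [norm_add_sq_sub_norm_sq hAB]
  have h1 : (⟪adjoint A y, B g⟫_ℂ).re ≤ ‖y‖ * ‖A g‖ := by
    have e : A (B g) = B (A g) := DFunLike.congr_fun hc.eq g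
    rw [adjoint_inner_left, e]
    refine (Complex.re_le_norm _).trans ((norm_inner_le_norm _ _).trans ?_)
    gcongr
    exact abs_le_of_sq_le_sq' (by nlinarith [hAB (A g), sq_nonneg ‖A (A g)‖]) (norm_nonneg _) |>.2
  nlinarith [sq_nonneg (‖y‖ - ‖A g‖)]

/-- A linear term bounded by a constant plus `‖A g‖²` is, after rotation and rescaling of `g`,
bounded by a multiple of `‖A g‖`, as Douglas' lemma requires. -/
theorem mem_range_adjoint_of_bddAbove {H : Type*} [NormedAddCommGroup H] [InnerProductSpace ℂ H] 
    [CompleteSpace H] {A B : H →L[ℂ] H}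
    (hAB : ∀ g, ‖A g‖ ^ 2 + ‖B g‖ ^ 2 = ‖g‖ ^ 2) (x : H)
    (h : BddAbove (Set.range fun g => ‖x + B g‖ ^ 2 - ‖g‖ ^ 2)) :
    ∃ y, adjoint B x = adjoint A y := by
  obtain ⟨M, hM⟩ := h
  have hM' : ∀ g, 2 * (⟪x, B g⟫_ℂ).re ≤ |M| + ‖A g‖ ^ 2 := fun g => by
    have := hM ⟨g, rfl⟩
    simp only [norm_add_sq_sub_norm_sq hAB] at this
    nlinarith [sq_nonneg ‖x‖, le_abs_self M]
  have hM2 : ∀ g, 2 * ‖⟪x, B g⟫_ℂ‖ ≤ |M| + ‖A g‖ ^ 2 := fun g => by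
    obtain ⟨c, hc, hcw⟩ : ∃ c : ℂ, ‖c‖ = 1 ∧ c * ⟪x, B g⟫_ℂ = ‖⟪x, B g⟫_ℂ‖ :=
      RCLike.exists_norm_eq_mul_self _ |>.imp fun c hc => ⟨hc.1, hc.2.symm⟩
    have := hM' (c • g)
    rw [map_smul, inner_smul_right, hcw, map_smul, norm_smul, hc, one_mul, Complex.ofReal_re] at this
    exact this
  refine mem_range_adjoint_of_bound A _ ((|M| + 1) / 2) fun g => ?_
  rw [adjoint_inner_left]
  rcases (norm_nonneg (A g)).eq_or_lt with h0 | h0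
  · rw [← h0, mul_zero]
    by_contra! hpos
    -- With `A g = 0` this scaling would give `2 (|M| + 1) ≤ |M|`.
    have := hM2 ((((|M| + 1) / ‖⟪x, B g⟫_ℂ‖ : ℝ) : ℂ) • g)
    rw [map_smul, inner_smul_right, map_smul, norm_smul, norm_mul, Complex.norm_real,
      Real.norm_of_nonneg (by positivity), ← h0, div_mul_cancel₀ _ hpos.ne'] at this
    nlinarith [abs_nonneg M]
  · have := hM2 (((1 / ‖A g‖ : ℝ) : ℂ) • g)
    rw [map_smul, inner_smul_right, map_smul, norm_smul, norm_mul, Complex.norm_real,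
      Real.norm_of_nonneg (by positivity), one_div, inv_mul_cancel₀ h0.ne', inv_mul_eq_div,
      one_pow] at this
    have h3 : ‖⟪x, B g⟫_ℂ‖ / ‖A g‖ ≤ (|M| + 1) / 2 := by linarith
    exact (div_le_iff₀ h0).1 h3

end DBR

/-! ### From coefficient sequences to functions on the disc -/

namespace DBR

open Polynomial ContinuousLinearMap
open scoped ComplexConjugate InnerProductSpace

theorem hasSum_of_forall_eq {f g : ℕ → ℂ} {s : ℂ} (h : ∀ n, f n = g n) (hf : HasSum f s) :
    HasSum g s :=
  funext h ▸ hf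

theorem mem_disc {z : ℂ} : z ∈ disc ↔ ‖z‖ < 1 := mem_ball_zero_iff

theorem isOpen_disc : IsOpen disc := Metric.isOpen_ball

theorem hasFPowerSeriesOnBall_of_hasSum {F : ℂ → ℂ} {c : ℕ → ℂ}
    (h : ∀ z ∈ disc, HasSum (fun n => c n * z ^ n) (F z)) :
    HasFPowerSeriesOnBall F (FormalMultilinearSeries.ofScalars ℂ c) 0 1 where
  r_le := by
    refine ENNReal.le_of_forall_nnreal_lt fun r hr => ?_
    have hr1 : (r : ℝ) < 1 := by exact_mod_cast hr
    refine FormalMultilinearSeries.le_radius_of_summable_norm _ ?_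
    have := (h (r : ℝ) (by rw [mem_disc]; simpa using hr1)).summable.norm
    simpa [FormalMultilinearSeries.ofScalars_norm] using this
  r_pos := one_pos
  hasSum := by
    intro y hy
    have hy' : y ∈ disc := by
      rw [mem_disc]
      rw [Metric.mem_eball, edist_zero_right] at hy
      have : (‖y‖₊ : ENNReal) < 1 := hy
      exact_mod_cast this
    have := h y hy'
    simpa [FormalMultilinearSeries.ofScalars_apply_eq, mul_comm] using this

theorem differentiableOn_of_hasSum {F : ℂ → ℂ} {c : ℕ → ℂ}
    (h : ∀ z ∈ disc, HasSum (fun n => c n * z ^ n) (F z)) : DifferentiableOn ℂ F disc := by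
  have := (hasFPowerSeriesOnBall_of_hasSum h).differentiableOn
  intro z hz
  refine (this z ?_).mono ?_
  · rw [Metric.mem_eball, edist_zero_right]
    have : ‖z‖₊ < 1 := mem_disc.1 hz
    show (‖z‖₊ : ENNReal) < 1
    exact_mod_cast this
  · intro w hw
    rw [Metric.mem_eball, edist_zero_right]
    have : ‖w‖₊ < 1 := mem_disc.1 hw
    show (‖w‖₊ : ENNReal) < 1
    exact_mod_cast this

theorem taylorCoeff_of_hasSum {F : ℂ → ℂ} {c : ℕ → ℂ}
    (h : ∀ z ∈ disc, HasSum (fun n => c n * z ^ n) (F z)) : taylorCoeff F = c := by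
  have h1 := (hasFPowerSeriesOnBall_of_hasSum h).hasFPowerSeriesAt
  have h2 := h1.analyticAt.hasFPowerSeriesAt
  exact FormalMultilinearSeries.ofScalars_series_injective ℂ ℂ (h2.eq_formalMultilinearSeries h1)

theorem hasSum_taylorCoeff {f : ℂ → ℂ} (hf : DifferentiableOn ℂ f disc) {z : ℂ} (hz : z ∈ disc) :
    HasSum (fun n => taylorCoeff f n * z ^ n) (f z) := by
  have := Complex.hasSum_taylorSeries_on_ball hf hz
  simp only [sub_zero, smul_eq_mul] at this
  refine hasSum_of_forall_eq (fun n => ?_) this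
  simp only [taylorCoeff]
  ring

/-- The function with Taylor coefficients `c`. -/
noncomputable def series (c : EllTwo) (z : ℂ) : ℂ := ∑' n, c n * z ^ n

theorem summable_sq_geometric {z : ℂ} (hz : ‖z‖ < 1) : Summable fun n => ‖conj z ^ n‖ ^ 2 := by
  have : (fun n => ‖conj z ^ n‖ ^ 2) = fun n => (‖z‖ ^ 2) ^ n := by
    ext n
    rw [norm_pow, Complex.norm_conj, ← pow_mul, ← pow_mul, mul_comm]
  rw [this]
  exact summable_geometric_of_lt_one (by positivity) (by nlinarith [norm_nonneg z])

/-- The Szegő kernel at `z`. -/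
noncomputable def kernel {z : ℂ} (hz : ‖z‖ < 1) : EllTwo :=
  ⟨fun n => conj z ^ n, memLp_two_iff.2 (summable_sq_geometric hz)⟩

theorem norm_kernel_sq {z : ℂ} (hz : ‖z‖ < 1) : ‖kernel hz‖ ^ 2 = (1 - ‖z‖ ^ 2)⁻¹ := by
  rw [EllTwo.norm_sq]
  have : (fun n => ‖kernel hz n‖ ^ 2) = fun n => (‖z‖ ^ 2) ^ n := by
    ext n
    show ‖conj z ^ n‖ ^ 2 = _
    rw [norm_pow, Complex.norm_conj, ← pow_mul, ← pow_mul, mul_comm]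
  rw [this]
  exact tsum_geometric_of_lt_one (by positivity) (by nlinarith [norm_nonneg z])

theorem hasSum_inner_kernel (c : EllTwo) {z : ℂ} (hz : ‖z‖ < 1) :
    HasSum (fun n => c n * z ^ n) ⟪kernel hz, c⟫_ℂ := by
  have := lp.hasSum_inner (𝕜 := ℂ) (kernel hz) c
  refine hasSum_of_forall_eq (fun n => ?_) this
  show c n * conj (conj z ^ n) = _
  rw [map_pow, Complex.conj_conj]

theorem hasSum_series (c : EllTwo) {z : ℂ} (hz : z ∈ disc) :
    HasSum (fun n => c n * z ^ n) (series c z) :=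
  (hasSum_inner_kernel c (mem_disc.1 hz)).summable.hasSum

/-- Cauchy–Schwarz against the Szegő kernel. That the exponent `1/2` is below `1` decides the final
comparison of growth rates. -/
theorem norm_series_le (c : EllTwo) {z : ℂ} (hz : ‖z‖ < 1) :
    ‖series c z‖ ≤ ‖c‖ / √(1 - ‖z‖) := by
  rw [series, (hasSum_inner_kernel c hz).tsum_eq]
  refine (norm_inner_le_norm _ _).trans ?_
  rw [div_eq_inv_mul]
  gcongr
  have h1 : 0 < 1 - ‖z‖ := by linarith
  rw [← Real.sqrt_inv]
  refine Real.le_sqrt_of_sq_le ?_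
  rw [norm_kernel_sq]
  exact inv_anti₀ h1 (by nlinarith [norm_nonneg z])

theorem differentiableOn_series (c : EllTwo) : DifferentiableOn ℂ (series c) disc :=
  differentiableOn_of_hasSum fun _ hz => hasSum_series c hz

theorem series_add (c d : EllTwo) {z : ℂ} (hz : z ∈ disc) :
    series (c + d) z = series c z + series d z := by
  refine (hasSum_series (c + d) hz).unique ?_
  exact hasSum_of_forall_eq (fun n => (add_mul _ _ _).symm)
    ((hasSum_series c hz).add (hasSum_series d hz))

theorem series_smul (k : ℂ) (c : EllTwo) {z : ℂ} (hz : z ∈ disc) :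
    series (k • c) z = k * series c z := by
  refine (hasSum_series (k • c) hz).unique ?_
  exact hasSum_of_forall_eq (fun n => (mul_assoc k (c n) (z ^ n)).symm)
    ((hasSum_series c hz).mul_left k)

theorem series_shift (c : EllTwo) {z : ℂ} (hz : z ∈ disc) :
    series (shift c) z = z * series c z := by
  refine (hasSum_series (shift c) hz).unique ?_
  rw [← hasSum_nat_add_iff' 1, Finset.sum_range_one, shift_zero, zero_mul, sub_zero]
  refine hasSum_of_forall_eq (fun n => ?_) ((hasSum_series c hz).mul_left z)
  rw [shift_succ]
  ring

theorem series_eq_add_mul (c : EllTwo) {z : ℂ} (hz : z ∈ disc) :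
    series c z = c 0 + z * series (adjoint shift c) z := by
  refine (hasSum_series c hz).unique ?_
  rw [← hasSum_nat_add_iff' 1, Finset.sum_range_one, pow_zero, mul_one, add_sub_cancel_left]
  refine hasSum_of_forall_eq (fun n => ?_) ((hasSum_series (adjoint shift c) hz).mul_left z)
  rw [adjoint_shift_apply]
  ring

theorem series_polyOp (p : ℂ[X]) (c : EllTwo) {z : ℂ} (hz : z ∈ disc) :
    series (polyOp p c) z = p.eval z * series c z := by
  induction p using Polynomial.induction_on' with
  | add p q hp hq =>
    rw [polyOp_add, add_apply, series_add _ _ hz, hp, hq, eval_add, add_mul]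
  | monomial n a =>
    have h1 : polyOp (monomial n a) = a • shift ^ n := by
      rw [← C_mul_X_pow_eq_monomial]
      simp [polyOp, Algebra.smul_def]
    rw [h1, smul_apply, series_smul _ _ hz, eval_monomial, mul_assoc]
    congr 1
    induction n with
    | zero => simp
    | succ n ih =>
      have : (shift ^ (n + 1)) c = shift ((shift ^ n) c) := by rw [pow_succ']; rfl
      rw [this, series_shift _ hz, ih (by simp [polyOp, ← C_mul_X_pow_eq_monomial,
        Algebra.smul_def]), pow_succ']
      ring

theorem mem_hardyTwo_of_eq_series {f : ℂ → ℂ} {c : EllTwo} (h : ∀ z ∈ disc, f z = series c z) :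
    f ∈ hardyTwo ∧ taylorCoeff f = c := by
  have hs : ∀ z ∈ disc, HasSum (fun n => c n * z ^ n) (f z) := fun z hz => by
    rw [h z hz]
    exact hasSum_series c hz
  have ht := taylorCoeff_of_hasSum hs
  refine ⟨⟨differentiableOn_of_hasSum hs, ?_⟩, ht⟩
  rw [ht]
  exact c.summable_sq

theorem hardyNormSq_of_eq_series {f : ℂ → ℂ} {c : EllTwo} (h : ∀ z ∈ disc, f z = series c z) :
    hardyNormSq f = ‖c‖ ^ 2 := by
  rw [hardyNormSq, (mem_hardyTwo_of_eq_series h).2, EllTwo.norm_sq]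

theorem exists_eq_series {f : ℂ → ℂ} (hf : f ∈ hardyTwo) :
    ∃ c : EllTwo, ∀ z ∈ disc, f z = series c z :=
  ⟨⟨taylorCoeff f, memLp_two_iff.2 hf.2⟩, fun _ hz => (hasSum_taylorCoeff hf.1 hz).tsum_eq.symm⟩

/-- If the values of `B` are `val b · series`, the numbers `dbrValues b f` are computed in `ℓ²`. -/
theorem dbrValues_eq_range {b : RatFunc ℂ} {B : EllTwo →L[ℂ] EllTwo}
    (hB : ∀ c, ∀ z ∈ disc, series (B c) z = val b z * series c z)
    {f : ℂ → ℂ} {x : EllTwo} (hf : ∀ z ∈ disc, f z = series x z) :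
    dbrValues b f = Set.range fun g => ‖x + B g‖ ^ 2 - ‖g‖ ^ 2 := by
  ext s
  constructor
  · rintro ⟨g, hg, rfl⟩
    obtain ⟨c, hc⟩ := exists_eq_series hg
    refine ⟨c, ?_⟩
    rw [hardyNormSq_of_eq_series hc, hardyNormSq_of_eq_series (c := x + B c)]
    intro z hz
    rw [series_add _ _ hz, hf z hz, hc z hz, hB c z hz]
  · rintro ⟨c, rfl⟩
    refine ⟨series c, (mem_hardyTwo_of_eq_series fun _ _ => rfl).1, ?_⟩
    rw [hardyNormSq_of_eq_series (c := c) fun _ _ => rfl, hardyNormSq_of_eq_series (c := x + B c)]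
    intro z hz
    rw [series_add _ _ hz, hf z hz, hB c z hz]

end DBR

/-! ### The space as the range of the adjoint of `p(S)` -/

namespace DBR

open Polynomial ContinuousLinearMap
open scoped ComplexConjugate InnerProductSpace

theorem val_eq_div (r : RatFunc ℂ) (z : ℂ) : val r z = r.num.eval z / r.denom.eval z := rfl

theorem exists_inv_polyOp {p : ℂ[X]} (hp : ∀ z : ℂ, ‖z‖ ≤ 1 → p.eval z ≠ 0) :
    ∃ R : EllTwo →L[ℂ] EllTwo, R * polyOp p = 1 ∧ polyOp p * R = 1 ∧
      ∀ q, Commute R (polyOp q) := by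
  obtain ⟨v, hv⟩ := isUnit_polyOp hp
  refine ⟨↑v⁻¹, by rw [← hv, v.inv_mul], by rw [← hv, v.mul_inv], fun q => ?_⟩
  have := polyOp_commute p q
  rw [← hv] at this
  exact this.units_inv_left

theorem series_inv_polyOp {p : ℂ[X]} (hp : ∀ z : ℂ, ‖z‖ ≤ 1 → p.eval z ≠ 0)
    {R : EllTwo →L[ℂ] EllTwo} (hR : polyOp p * R = 1) (c : EllTwo) {z : ℂ} (hz : z ∈ disc) :
    series (R c) z = series c z / p.eval z := by
  rw [eq_div_iff (hp z (mem_disc.1 hz).le), mul_comm, ← series_polyOp p _ hz]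
  exact congrArg (fun d => series d z) (DFunLike.congr_fun hR c)

variable {b a : RatFunc ℂ}

theorem IsPythagoreanMate.eval_num_ne_zero (ha : IsPythagoreanMate b a) {z : ℂ} (hz : z ∈ disc) :
    a.num.eval z ≠ 0 := by
  intro h
  exact ha.outer z hz (by rw [val_eq_div, h, zero_div])

theorem IsPythagoreanMate.eval_num_or (ha : IsPythagoreanMate b a) {z : ℂ} (hz : ‖z‖ ≤ 1) :
    a.num.eval z ≠ 0 ∨ b.num.eval z ≠ 0 := by
  rcases hz.lt_or_eq with h | h
  · exact Or.inl (ha.eval_num_ne_zero (mem_disc.2 h))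
  · by_contra! h0
    have := ha.sq_add_sq z h
    simp [val_eq_div, h0.1, h0.2] at this

/-- If `A` and `B` are the multiplication operators by `a` and `b`, then `A*A + B*B = 1`. -/
theorem norm_sq_add_norm_sq (hb : NoPoles b) (ha : IsPythagoreanMate b a)
    {Ra Rb : EllTwo →L[ℂ] EllTwo} (hRa : polyOp a.denom * Ra = 1) (hRb : polyOp b.denom * Rb = 1)
    (hca : ∀ q, Commute Ra (polyOp q)) (hcb : ∀ q, Commute Rb (polyOp q)) (g : EllTwo) :
    ‖(Ra * polyOp a.num) g‖ ^ 2 + ‖(Rb * polyOp b.num) g‖ ^ 2 = ‖g‖ ^ 2 := by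
  -- Denominators are cleared in `|a|² + |b|² = 1`, and the polynomial identity is applied to `g`
  -- divided by both denominators.
  have key := norm_polyOp_sq_add_sq (p := a.num * b.denom) (q := b.num * a.denom)
    (r := b.denom * a.denom) (fun z hz => by
      have h := ha.sq_add_sq z hz
      have h1 := hb z hz.le
      have h2 := ha.noPoles z hz.le
      rw [val_eq_div, val_eq_div, norm_div, norm_div] at h
      have h1' : ‖b.denom.eval z‖ ≠ 0 := norm_ne_zero_iff.2 h1
      have h2' : ‖a.denom.eval z‖ ≠ 0 := norm_ne_zero_iff.2 h2
      simp only [eval_mul, norm_mul]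
      field_simp at h
      linear_combination h) (Ra (Rb g))
  have e1 : polyOp (a.num * b.denom) * (Ra * Rb) = Ra * polyOp a.num := by
    calc polyOp (a.num * b.denom) * (Ra * Rb)
        = polyOp a.num * (polyOp b.denom * Ra) * Rb := by rw [polyOp_mul]; simp only [mul_assoc]
      _ = polyOp a.num * Ra * (polyOp b.denom * Rb) := by
        rw [← (hca b.denom).eq]; simp only [mul_assoc]
      _ = Ra * polyOp a.num := by rw [hRb, mul_one, (hca _).eq]
  have e2 : polyOp (b.num * a.denom) * (Ra * Rb) = Rb * polyOp b.num := by
    calc polyOp (b.num * a.denom) * (Ra * Rb)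
        = polyOp b.num * (polyOp a.denom * Ra) * Rb := by rw [polyOp_mul]; simp only [mul_assoc]
      _ = Rb * polyOp b.num := by rw [hRa, mul_one, (hcb _).eq]
  have e3 : polyOp (b.denom * a.denom) * (Ra * Rb) = 1 := by
    calc polyOp (b.denom * a.denom) * (Ra * Rb)
        = polyOp b.denom * (polyOp a.denom * Ra) * Rb := by rw [polyOp_mul]; simp only [mul_assoc]
      _ = 1 := by rw [hRa, mul_one, hRb]
  rw [← e1, ← e2]
  refine key.trans ?_
  exact congrArg (fun x => ‖x‖ ^ 2) (DFunLike.congr_fun e3 g)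

/-- If `B† x` is in the range of `A†`, where `A = Ra p` and `B = Rb q`, and `p`, `q` have no common
zeros in the closed disc, then `x` is in the range of `p(S)†`. -/
theorem exists_eq_adjoint_polyOp {p q r : ℂ[X]} (hpq : ∀ z : ℂ, ‖z‖ ≤ 1 → p.eval z ≠ 0 ∨ q.eval z ≠ 0)
    {Ra Rb : EllTwo →L[ℂ] EllTwo} (hRb : polyOp r * Rb = 1)
    (hca : ∀ q, Commute Ra (polyOp q))
    {x y : EllTwo} (h : adjoint (Rb * polyOp q) x = adjoint (Ra * polyOp p) y)
    (hcb : ∀ q, Commute Rb (polyOp q)) :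
    ∃ k, x = adjoint (polyOp p) k := by
  classical
  -- With `d = p s + q t`, both terms of `d(S)† x` lie in the range of `p(S)†`. The operator `d(S)`
  -- is invertible, as `d` has no zero in the closed disc, and its inverse commutes with `p(S)`.
  set d := EuclideanDomain.gcd p q
  have hd : ∀ z : ℂ, ‖z‖ ≤ 1 → d.eval z ≠ 0 := by
    intro z hz h0
    have h1 : p.eval z = 0 := eval_eq_zero_of_dvd_of_eval_eq_zero (EuclideanDomain.gcd_dvd_left p q) h0
    have h2 : q.eval z = 0 := eval_eq_zero_of_dvd_of_eval_eq_zero (EuclideanDomain.gcd_dvd_right p q) h0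
    exact (hpq z hz).elim (· h1) (· h2)
  obtain ⟨D, -, hD, hDc⟩ := exists_inv_polyOp hd
  set s := EuclideanDomain.gcdA p q
  set t := EuclideanDomain.gcdB p q
  have hst : d = p * s + q * t := EuclideanDomain.gcd_eq_gcd_ab p q
  simp only [← star_eq_adjoint] at h ⊢
  have hq : star (polyOp q) x = star (polyOp p) ((star Ra * star (polyOp r)) y) := by
    have e1 : star (polyOp r) * star (Rb * polyOp q) = star (polyOp q) := by
      rw [← star_mul, ← (hcb q).eq.symm, mul_assoc, ← (hcb r).eq.symm, hRb, mul_one]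
    have e2 : star (polyOp r) * star (Ra * polyOp p)
        = star (polyOp p) * (star Ra * star (polyOp r)) := by
      rw [← star_mul, ← star_mul, ← star_mul]
      congr 1
      rw [mul_assoc, (polyOp_commute p r).eq, ← mul_assoc, (hca r).eq]
    calc star (polyOp q) x = star (polyOp r) (star (Rb * polyOp q) x) :=
          (DFunLike.congr_fun e1 x).symm
      _ = star (polyOp r) (star (Ra * polyOp p) y) := by rw [h]
      _ = _ := DFunLike.congr_fun e2 y
  have hdx : star (polyOp d) x = star (polyOp p)
      (star (polyOp s) x + star (polyOp t) ((star Ra * star (polyOp r)) y)) := by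
    have e1 : star (polyOp d) = star (polyOp p) * star (polyOp s)
        + star (polyOp t) * star (polyOp q) := by
      rw [hst, polyOp_add, polyOp_mul, polyOp_mul, star_add, (polyOp_commute p s).eq,
        star_mul, star_mul]
    have e2 : star (polyOp t) * star (polyOp p) = star (polyOp p) * star (polyOp t) := by
      rw [← star_mul, ← star_mul, (polyOp_commute p t).eq]
    calc star (polyOp d) x
        = star (polyOp p) (star (polyOp s) x) + star (polyOp t) (star (polyOp q) x) :=
          DFunLike.congr_fun e1 x
      _ = _ := by
        rw [hq, map_add]
        congr 1
        exact DFunLike.congr_fun e2 _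
  have e3 : star D * star (polyOp d) = 1 := by rw [← star_mul, hD, star_one]
  have e4 : star D * star (polyOp p) = star (polyOp p) * star D := by
    rw [← star_mul, ← star_mul, (hDc p).eq]
  refine ⟨star D (star (polyOp s) x + star (polyOp t) ((star Ra * star (polyOp r)) y)), ?_⟩
  calc x = star D (star (polyOp d) x) := (DFunLike.congr_fun e3 x).symm
    _ = _ := by
      rw [hdx]
      exact DFunLike.congr_fun e4 _

theorem mem_dbrSpace_iff (hb : NoPoles b) (ha : IsPythagoreanMate b a) {f : ℂ → ℂ} {x : EllTwo}
    (hf : ∀ z ∈ disc, f z = series x z) :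
    f ∈ dbrSpace b ↔ ∃ y, x = adjoint (polyOp a.num) y := by
  obtain ⟨Ra, -, hRa, hca⟩ := exists_inv_polyOp ha.noPoles
  obtain ⟨Rb, -, hRb, hcb⟩ := exists_inv_polyOp hb
  have hsum := norm_sq_add_norm_sq hb ha hRa hRb hca hcb
  have hB : ∀ c, ∀ z ∈ disc, series ((Rb * polyOp b.num) c) z = val b z * series c z := by
    intro c z hz
    have := series_inv_polyOp hb hRb (polyOp b.num c) hz
    rw [series_polyOp _ _ hz] at this
    rw [val_eq_div, div_mul_eq_mul_div]
    exact this
  have hv := dbrValues_eq_range hB hf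
  have hH := (mem_hardyTwo_of_eq_series hf).1
  constructor
  · rintro ⟨-, hbdd⟩
    rw [hv] at hbdd
    obtain ⟨y, hy⟩ := mem_range_adjoint_of_bddAbove hsum x hbdd
    exact exists_eq_adjoint_polyOp (fun z hz => ha.eval_num_or hz) hRb hca hy hcb
  · rintro ⟨y, rfl⟩
    refine ⟨hH, ?_⟩
    rw [hv]
    have hRab : Commute Ra Rb := by
      have e := (hca b.denom).eq
      calc Ra * Rb = (Rb * polyOp b.denom) * Ra * Rb := by
            rw [(hcb _).eq, hRb, one_mul]
        _ = Rb * (Ra * polyOp b.denom) * Rb := by rw [e, mul_assoc Rb]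
        _ = Rb * Ra := by rw [mul_assoc, mul_assoc, hRb, mul_one]
    have hAB : Commute (Ra * polyOp a.num) (Rb * polyOp b.num) :=
      (hRab.mul_right (hca _)).mul_left (((hcb _).symm).mul_right (polyOp_commute _ _))
    have e : adjoint (polyOp a.num) y = adjoint (Ra * polyOp a.num) (adjoint (polyOp a.denom) y) := by
      simp only [← star_eq_adjoint]
      have : star (polyOp a.num) = star (Ra * polyOp a.num) * star (polyOp a.denom) := by
        rw [← star_mul, ← mul_assoc, hRa, one_mul]
      exact DFunLike.congr_fun this y
    rw [e]
    exact bddAbove_of_mem_range_adjoint hsum hAB _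

end DBR

/-! ### Local form at the circle and test functions -/

namespace DBR

open Polynomial ContinuousLinearMap Filter Topology
open scoped ComplexConjugate InnerProductSpace

theorem conj_mul_self_of_norm_one {ζ : ℂ} (hζ : ‖ζ‖ = 1) : conj ζ * ζ = 1 := by
  rw [mul_comm, Complex.mul_conj, Complex.normSq_eq_norm_sq, hζ]
  simp

theorem polyOp_X : polyOp X = shift := by simp [polyOp]

theorem polyOp_C (r : ℂ) : polyOp (C r) = r • 1 := by simp [polyOp, Algebra.smul_def]

theorem adjoint_polyOp_mul_apply (p q : ℂ[X]) (c : EllTwo) :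
    adjoint (polyOp (p * q)) c = adjoint (polyOp q) (adjoint (polyOp p) c) := by
  simp only [← star_eq_adjoint]
  rw [polyOp_mul, star_mul]
  rfl

theorem adjoint_polyOp_add_apply (p q : ℂ[X]) (c : EllTwo) :
    adjoint (polyOp (p + q)) c = adjoint (polyOp p) c + adjoint (polyOp q) c := by
  rw [polyOp_add, map_add]
  rfl

theorem adjoint_polyOp_C_apply (r : ℂ) (c : EllTwo) :
    adjoint (polyOp (C r)) c = conj r • c := by
  rw [polyOp_C, ← star_eq_adjoint, star_smul, star_one]
  rfl

/-- Because `conj ζ * ζ = 1`, the adjoint of `S - ζ` also produces a factor `z - ζ`, up to an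
additive constant. -/
theorem series_adjoint_X_sub_C {ζ : ℂ} (hζ : ‖ζ‖ = 1) (c : EllTwo) {z : ℂ} (hz : z ∈ disc) :
    series (adjoint (polyOp (X - C ζ)) c) z
      = -conj ζ * c 0 + -conj ζ * ((z - ζ) * series (adjoint shift c) z) := by
  have h : X - C ζ = X + C (-ζ) := by rw [C_neg, sub_eq_add_neg]
  rw [h, adjoint_polyOp_add_apply, adjoint_polyOp_C_apply, polyOp_X, series_add _ _ hz,
    series_smul _ _ hz, series_eq_add_mul c hz, map_neg]
  linear_combination (-series (adjoint shift c) z) * conj_mul_self_of_norm_one hζ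

/-- Elements of the range of `((S - ζ)†) ^ m` agree to order `m` with a polynomial at `ζ`. -/
theorem exists_eq_polynomial_add {ζ : ℂ} (hζ : ‖ζ‖ = 1) (m : ℕ) (c : EllTwo) :
    ∃ (P : ℂ[X]) (h : EllTwo), ∀ z ∈ disc,
      series (adjoint (polyOp ((X - C ζ) ^ m)) c) z = P.eval z + (z - ζ) ^ m * series h z := by
  induction m generalizing c with
  | zero =>
    refine ⟨0, c, fun z _ => ?_⟩
    rw [pow_zero, ← C_1, adjoint_polyOp_C_apply]
    simp
  | succ m ih =>
    -- The new factor `z - ζ` comes multiplied by the backward shift of the series, hence the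
    -- induction over all `c`.
    obtain ⟨P, h, hP⟩ := ih (adjoint shift c)
    refine ⟨C (-conj ζ * adjoint (polyOp ((X - C ζ) ^ m)) c 0) + C (-conj ζ) * ((X - C ζ) * P),
      (-conj ζ) • h, fun z hz => ?_⟩
    rw [pow_succ, adjoint_polyOp_mul_apply, series_adjoint_X_sub_C hζ _ hz]
    have : adjoint shift (adjoint (polyOp ((X - C ζ) ^ m)) c)
        = adjoint (polyOp ((X - C ζ) ^ m)) (adjoint shift c) := by
      rw [← polyOp_X, ← adjoint_polyOp_mul_apply, ← adjoint_polyOp_mul_apply, mul_comm]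
    rw [this, hP z hz, series_smul _ _ hz]
    simp only [eval_add, eval_mul, eval_C, eval_sub, eval_X]
    ring

variable {b a : RatFunc ℂ}

theorem exists_local_form (hb : NoPoles b) (ha : IsPythagoreanMate b a) {f : ℂ → ℂ}
    (hf : f ∈ dbrSpace b) {ζ : ℂ} (hζ : ‖ζ‖ = 1) :
    ∃ (P : ℂ[X]) (h : EllTwo), ∀ z ∈ disc,
      f z = P.eval z + (z - ζ) ^ zeroMult a ζ * series h z := by
  obtain ⟨x, hx⟩ := exists_eq_series hf.1
  obtain ⟨y, rfl⟩ := (mem_dbrSpace_iff hb ha hx).1 hf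
  obtain ⟨p, hp⟩ := pow_rootMultiplicity_dvd a.num ζ
  obtain ⟨P, h, hP⟩ := exists_eq_polynomial_add hζ (zeroMult a ζ) (adjoint (polyOp p) y)
  refine ⟨P, h, fun z hz => ?_⟩
  rw [← hP z hz, hx z hz, ← adjoint_polyOp_mul_apply, mul_comm p]
  exact congrArg (fun q => series (adjoint (polyOp q) y) z) hp

theorem adjoint_shift_single_zero : adjoint shift (lp.single 2 0 1 : EllTwo) = 0 := by
  ext n
  simp

theorem adjoint_shift_single_one :
    adjoint shift (lp.single 2 1 1 : EllTwo) = lp.single 2 0 1 := by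
  have h : (lp.single 2 1 1 : EllTwo) = shift (lp.single 2 0 1) := (shift_single 0).symm
  rw [h]
  exact DFunLike.congr_fun adjoint_shift_mul_shift (lp.single 2 0 1)

theorem adjoint_polyOp_single_zero (p : ℂ[X]) :
    adjoint (polyOp p) (lp.single 2 0 1 : EllTwo) = conj (p.coeff 0) • lp.single 2 0 1 := by
  conv_lhs => rw [← X_mul_divX_add p]
  rw [adjoint_polyOp_add_apply, adjoint_polyOp_mul_apply, polyOp_X, adjoint_shift_single_zero,
    map_zero, zero_add, adjoint_polyOp_C_apply]

theorem adjoint_polyOp_single_one (p : ℂ[X]) :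
    adjoint (polyOp p) (lp.single 2 1 1 : EllTwo)
      = conj (p.coeff 1) • lp.single 2 0 1 + conj (p.coeff 0) • lp.single 2 1 1 := by
  conv_lhs => rw [← X_mul_divX_add p]
  rw [adjoint_polyOp_add_apply, adjoint_polyOp_mul_apply, polyOp_X, adjoint_shift_single_one,
    adjoint_polyOp_single_zero, adjoint_polyOp_C_apply, coeff_divX]

theorem series_single (n : ℕ) (z : ℂ) : series (lp.single 2 n 1) z = z ^ n := by
  rw [series, tsum_eq_single n]
  · simp
  · intro k hk
    simp [hk]

theorem IsPythagoreanMate.coeff_zero_ne_zero (ha : IsPythagoreanMate b a) :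
    a.num.coeff 0 ≠ 0 := by
  rw [coeff_zero_eq_eval_zero]
  exact ha.eval_num_ne_zero (mem_disc.2 (by simp))

theorem one_mem_dbrSpace (hb : NoPoles b) (ha : IsPythagoreanMate b a) :
    (fun _ => 1) ∈ dbrSpace b := by
  have h0 : conj (a.num.coeff 0) ≠ 0 := (_root_.map_ne_zero _).2 ha.coeff_zero_ne_zero
  refine (mem_dbrSpace_iff hb ha (x := lp.single 2 0 1) fun z _ => by
    rw [series_single, pow_zero]).2 ⟨(conj (a.num.coeff 0))⁻¹ • lp.single 2 0 1, ?_⟩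
  rw [map_smul, adjoint_polyOp_single_zero, smul_smul, inv_mul_cancel₀ h0, one_smul]

/-- On the span of `1` and `z` the operator `p(S)†` is triangular with diagonal entry `conj (p 0) ≠
0`, so the preimage is explicit. -/
theorem id_mem_dbrSpace (hb : NoPoles b) (ha : IsPythagoreanMate b a) :
    (fun z => z) ∈ dbrSpace b := by
  have h0 : conj (a.num.coeff 0) ≠ 0 := (_root_.map_ne_zero _).2 ha.coeff_zero_ne_zero
  refine (mem_dbrSpace_iff hb ha (x := lp.single 2 1 1) fun z _ => by
    rw [series_single, pow_one]).2 ⟨(conj (a.num.coeff 0))⁻¹ • (lp.single 2 1 1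
      - (conj (a.num.coeff 1) * (conj (a.num.coeff 0))⁻¹) • lp.single 2 0 1), ?_⟩
  rw [map_smul, map_sub, map_smul, adjoint_polyOp_single_zero, adjoint_polyOp_single_one, smul_smul,
    mul_assoc, inv_mul_cancel₀ h0, mul_one, add_sub_cancel_left, smul_smul, inv_mul_cancel₀ h0,
    one_smul]

/-- Up to a function continuous at `w`, the operator `p(S)†` multiplies by `conj (p (1 / conj z))`. -/
theorem exists_series_adjoint_polyOp {w : ℂ} (hw : w ≠ 0) (p : ℂ[X]) (c : EllTwo) :
    ∃ R : ℂ → ℂ, ContinuousAt R w ∧ ∀ z ∈ disc, z ≠ 0 →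
      series (adjoint (polyOp p) c) z = (p.map (starRingEnd ℂ)).eval z⁻¹ * series c z + R z := by
  induction p using Polynomial.induction_on with
  | C r =>
    refine ⟨0, continuousAt_const, fun z hz _ => ?_⟩
    rw [adjoint_polyOp_C_apply, series_smul _ _ hz]
    simp
  | add p q hp hq =>
    obtain ⟨R, hR, h⟩ := hp
    obtain ⟨R', hR', h'⟩ := hq
    refine ⟨R + R', hR.add hR', fun z hz hz0 => ?_⟩
    rw [adjoint_polyOp_add_apply, series_add _ _ hz, h z hz hz0, h' z hz hz0, Polynomial.map_add,
      eval_add, Pi.add_apply]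
    ring
  | monomial n r hp =>
    obtain ⟨R, hR, h⟩ := hp
    set d := adjoint (polyOp (C r * X ^ n)) c
    -- The backward shift is `d ↦ (d - d 0) / z`: the multiplier gains a factor `z⁻¹` and the
    -- remainder becomes `(R - d 0) / z`.
    refine ⟨fun z => z⁻¹ * (R z - d 0), (continuousAt_inv₀ hw).mul (hR.sub continuousAt_const),
      fun z hz hz0 => ?_⟩
    have e := h z hz hz0
    rw [series_eq_add_mul d hz] at e
    rw [pow_succ, ← mul_assoc, adjoint_polyOp_mul_apply, polyOp_X]
    have e2 : series (adjoint shift d) z = z⁻¹ * (z * series (adjoint shift d) z) := by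
      rw [inv_mul_cancel_left₀ hz0]
    rw [e2, eq_sub_of_add_eq' e]
    simp only [Polynomial.map_mul, eval_mul, map_X, eval_X]
    ring

theorem summable_sq_log {w : ℂ} (hw : ‖w‖ = 1) : Summable fun n : ℕ => ‖conj w ^ n / n‖ ^ 2 := by
  -- At `n = 0` both sides are `0` by the convention for division by zero, matching the missing
  -- constant term of the logarithm.
  have : (fun n : ℕ => ‖conj w ^ n / n‖ ^ 2) = fun n : ℕ => 1 / (n : ℝ) ^ 2 := by
    ext n
    rw [norm_div, norm_pow, Complex.norm_conj, hw, one_pow, Complex.norm_natCast, div_pow, one_pow]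
  rw [this]
  exact Real.summable_one_div_nat_pow.2 one_lt_two

/-- The coefficients of `-log (1 - conj w * z)`. -/
noncomputable def logSeq {w : ℂ} (hw : ‖w‖ = 1) : EllTwo :=
  ⟨fun n => conj w ^ n / n, memLp_two_iff.2 (summable_sq_log hw)⟩

theorem series_logSeq {w : ℂ} (hw : ‖w‖ = 1) {z : ℂ} (hz : z ∈ disc) :
    series (logSeq hw) z = -Complex.log (1 - conj w * z) := by
  have h := Complex.hasSum_taylorSeries_neg_log (z := conj w * z)
    (by rw [norm_mul, Complex.norm_conj, hw, one_mul]; exact mem_disc.1 hz)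
  refine (hasSum_series (logSeq hw) hz).unique (hasSum_of_forall_eq (fun n => ?_) h)
  show _ = conj w ^ n / n * z ^ n
  rw [mul_pow]
  ring

theorem tendsto_norm_series_logSeq {w : ℂ} (hw : ‖w‖ = 1) :
    Tendsto (fun z => ‖series (logSeq hw) z‖) (𝓝[disc] w) atTop := by
  have h1 : Tendsto (fun z => ‖1 - conj w * z‖) (𝓝[disc] w) (𝓝[≠] 0) := by
    refine tendsto_nhdsWithin_iff.2 ⟨?_, ?_⟩
    · have : ContinuousAt (fun z => ‖1 - conj w * z‖) w := by fun_prop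
      have h := this.tendsto
      rw [conj_mul_self_of_norm_one hw, sub_self, norm_zero] at h
      exact h.mono_left nhdsWithin_le_nhds
    · filter_upwards [self_mem_nhdsWithin] with z hz h0
      have h2 : conj w * z = 1 := (sub_eq_zero.1 (norm_eq_zero.1 h0)).symm
      have := congrArg norm h2
      rw [norm_mul, Complex.norm_conj, hw, one_mul, norm_one] at this
      exact (mem_disc.1 hz).ne this
  have h2 := tendsto_neg_atBot_atTop.comp (Real.tendsto_log_nhdsNE_zero.comp h1)
  refine tendsto_atTop_mono' _ ?_ h2
  filter_upwards [self_mem_nhdsWithin] with z hz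
  rw [series_logSeq hw hz, norm_neg]
  have := Complex.abs_re_le_norm (Complex.log (1 - conj w * z))
  rw [Complex.log_re] at this
  exact (neg_le_abs _).trans this

/-- At a point of the circle where `a` does not vanish, some function of `H(b)` tends to `∞`. -/
theorem exists_mem_dbrSpace_tendsto_atTop (hb : NoPoles b) (ha : IsPythagoreanMate b a) {w : ℂ}
    (hw : ‖w‖ = 1) (hwa : w ∉ circleZeros a) :
    ∃ c : EllTwo, series c ∈ dbrSpace b ∧ Tendsto (fun z => ‖series c z‖) (𝓝[disc] w) atTop := by
  have hw0 : w ≠ 0 := by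
    rintro rfl
    simp at hw
  have hp : a.num.eval w ≠ 0 := fun h => hwa ⟨hw, by rw [val_eq_div, h, zero_div]⟩
  -- Near `w` the operator `p(S)†` multiplies the logarithm by a factor tending to `conj (p w) ≠ 0`,
  -- up to a bounded error, so the blow-up survives.
  refine ⟨adjoint (polyOp a.num) (logSeq hw),
    (mem_dbrSpace_iff hb ha fun _ _ => rfl).2 ⟨_, rfl⟩, ?_⟩
  obtain ⟨R, hR, h⟩ := exists_series_adjoint_polyOp hw0 a.num (logSeq hw)
  have h1 : Tendsto (fun z => ‖(a.num.map (starRingEnd ℂ)).eval z⁻¹‖) (𝓝[disc] w)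
      (𝓝 ‖a.num.eval w‖) := by
    have hc : ContinuousAt (fun z : ℂ => ‖(a.num.map (starRingEnd ℂ)).eval z⁻¹‖) w :=
      ((Polynomial.continuous _).continuousAt.comp (continuousAt_inv₀ hw0)).norm
    have e : (a.num.map (starRingEnd ℂ)).eval w⁻¹ = conj (a.num.eval w) := by
      rw [← eq_inv_of_mul_eq_one_left (conj_mul_self_of_norm_one hw), eval_map, eval₂_at_apply]
    have := hc.tendsto
    rw [e, Complex.norm_conj] at this
    exact this.mono_left nhdsWithin_le_nhds
  have h2 := (h1.pos_mul_atTop (norm_pos_iff.2 hp) (tendsto_norm_series_logSeq hw)).atTop_add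
    (hR.norm.neg.tendsto.mono_left (nhdsWithin_le_nhds (s := disc)))
  refine tendsto_atTop_mono' _ ?_ h2
  filter_upwards [self_mem_nhdsWithin, nhdsWithin_le_nhds (isOpen_ne.mem_nhds hw0)] with z hz hz0
  rw [h z hz hz0, ← norm_mul]
  have := norm_sub_norm_le ((a.num.map (starRingEnd ℂ)).eval z⁻¹ * series (logSeq hw) z) (-R z)
  rwa [sub_neg_eq_add, norm_neg] at this

end DBR

/-! ### Non-tangential limits and growth near the circle -/

namespace DBR

open Polynomial ContinuousLinearMap Filter Topology
open scoped ComplexConjugate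

theorem one_sub_norm_le {ζ : ℂ} (hζ : ‖ζ‖ = 1) (z : ℂ) : 1 - ‖z‖ ≤ ‖z - ζ‖ := by
  rw [← hζ, norm_sub_rev z]
  exact norm_sub_norm_le _ _

theorem ne_of_mem_disc {ζ z : ℂ} (hζ : ‖ζ‖ = 1) (hz : z ∈ disc) : z - ζ ≠ 0 := fun h => by
  have := one_sub_norm_le hζ z
  rw [h, norm_zero] at this
  linarith [mem_disc.1 hz]

theorem eventually_mem_disc (ζ : ℂ) (α : ℝ) : ∀ᶠ z in 𝓝[stolz ζ α] ζ, z ∈ disc := by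
  filter_upwards [self_mem_nhdsWithin] with z hz
  exact mem_disc.2 hz.1

theorem neBot_nhdsWithin_stolz {ζ : ℂ} (hζ : ‖ζ‖ = 1) {α : ℝ} (hα : 1 < α) :
    (𝓝[stolz ζ α] ζ).NeBot := by
  have h : Tendsto (fun r : ℝ => (r : ℂ) * ζ) (𝓝[<] 1) (𝓝[stolz ζ α] ζ) := by
    refine tendsto_nhdsWithin_iff.2 ⟨?_, ?_⟩
    · have : ContinuousAt (fun r : ℝ => (r : ℂ) * ζ) 1 := by fun_prop
      have h := this.tendsto
      rw [Complex.ofReal_one, one_mul] at h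
      exact h.mono_left nhdsWithin_le_nhds
    · filter_upwards [Ioo_mem_nhdsLT (zero_lt_one' ℝ)] with r hr
      have h1 : ‖(r : ℂ) * ζ‖ = r := by
        rw [norm_mul, hζ, mul_one, Complex.norm_real, Real.norm_of_nonneg hr.1.le]
      have h2 : ‖(r : ℂ) * ζ - ζ‖ = 1 - r := by
        have : (r : ℂ) * ζ - ζ = ((r - 1 : ℝ) : ℂ) * ζ := by push_cast; ring
        rw [this, norm_mul, hζ, mul_one, Complex.norm_real, Real.norm_of_nonpos (by linarith [hr.2])]
        ring
      refine ⟨by rw [h1]; exact hr.2, ?_⟩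
      rw [h1, h2]
      nlinarith [hr.2]
  exact h.neBot

theorem tendsto_norm_sub (ζ : ℂ) (s : Set ℂ) : Tendsto (fun z => ‖z - ζ‖) (𝓝[s] ζ) (𝓝 0) := by
  have : ContinuousAt (fun z => ‖z - ζ‖) ζ := by fun_prop
  have h := this.tendsto
  rw [sub_self, norm_zero] at h
  exact h.mono_left nhdsWithin_le_nhds

theorem differentiableOn_pow_mul_series (ζ : ℂ) (m : ℕ) (h : EllTwo) :
    DifferentiableOn ℂ (fun z => (z - ζ) ^ m * series h z) disc :=
  DifferentiableOn.mul (by fun_prop) (differentiableOn_series h)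

/-- Derivatives of `(z - ζ) ^ m * h` of order `< m` have non-tangential limit `0`, for `h ∈ H²`. -/
theorem hasNTLimit_iteratedDeriv_pow_mul_series {ζ : ℂ} (hζ : ‖ζ‖ = 1) {m l : ℕ} (hl : l < m)
    (h : EllTwo) : HasNTLimit (iteratedDeriv l fun z => (z - ζ) ^ m * series h z) ζ 0 := by
  intro α hα
  set K : ℝ := l.factorial * ‖h‖ * (4 * α) ^ (l + 1) with hK
  have hlim : Tendsto (fun z => K * √‖z - ζ‖) (𝓝[stolz ζ α] ζ) (𝓝 0) := by
    have := ((Real.continuous_sqrt.tendsto 0).comp (tendsto_norm_sub ζ (stolz ζ α))).const_mul K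
    rwa [Real.sqrt_zero, mul_zero] at this
  refine squeeze_zero_norm' ?_ hlim
  filter_upwards [self_mem_nhdsWithin, (tendsto_norm_sub ζ (stolz ζ α)).eventually
    (gt_mem_nhds (show (0 : ℝ) < 1 / 2 by norm_num))] with z hz ht
  obtain ⟨hz1, hz2⟩ := hz
  have hle := one_sub_norm_le hζ z
  set t := ‖z - ζ‖
  -- Cauchy's estimate is used on the circle of radius `ρ` about `z`. There `|w - ζ| ≤ 2t ≤ 4αρ` and
  -- `|h(w)| ≤ ‖h‖ / √ρ`, so the derivative of order `l` is at most `K √ρ`.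
  set ρ := (1 - ‖z‖) / 2 with hρ
  have hρ0 : 0 < ρ := by rw [hρ]; linarith
  have hsphere : ∀ w, ‖w - z‖ ≤ ρ → ρ ≤ 1 - ‖w‖ ∧ ‖w - ζ‖ ≤ 2 * t := by
    intro w hw
    have h1 : ‖w‖ ≤ ‖w - z‖ + ‖z‖ := norm_le_norm_sub_add w z
    have h2 : ‖w - ζ‖ ≤ ‖w - z‖ + ‖z - ζ‖ := norm_sub_le_norm_sub_add_norm_sub w z ζ
    constructor <;> linarith
  have hsub : Metric.closedBall z ρ ⊆ disc := by
    intro w hw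
    rw [mem_closedBall_iff_norm] at hw
    exact mem_disc.2 (by linarith [(hsphere w hw).1])
  have hd : DiffContOnCl ℂ (fun z => (z - ζ) ^ m * series h z) (Metric.ball z ρ) :=
    ((differentiableOn_pow_mul_series ζ m h).mono hsub).diffContOnCl_ball subset_rfl
  have hb : ∀ w ∈ Metric.sphere z ρ, ‖(w - ζ) ^ m * series h w‖ ≤ (4 * α * ρ) ^ (l + 1) * (‖h‖ / √ρ) := by
    intro w hw
    obtain ⟨hw1, hw2⟩ := hsphere w (mem_sphere_iff_norm.1 hw).le
    rw [norm_mul, norm_pow]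
    have h3 : ‖series h w‖ ≤ ‖h‖ / √ρ := by
      refine (norm_series_le h (by linarith)).trans ?_
      gcongr
    have h4 : ‖w - ζ‖ ^ m ≤ (4 * α * ρ) ^ (l + 1) :=
      calc ‖w - ζ‖ ^ m ≤ (2 * t) ^ m := by gcongr
        _ ≤ (2 * t) ^ (l + 1) := pow_le_pow_of_le_one (by positivity) (by linarith) hl
        _ ≤ (4 * α * ρ) ^ (l + 1) :=
          pow_le_pow_left₀ (by positivity) (by rw [hρ]; linarith) _
    gcongr
  refine (Complex.norm_iteratedDeriv_le_of_forall_mem_sphere_norm_le l hρ0 hd hb).trans ?_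
  have hsq : √ρ * √ρ = ρ := Real.mul_self_sqrt hρ0.le
  have hsq0 : 0 < √ρ := Real.sqrt_pos.2 hρ0
  have e : l.factorial * ((4 * α * ρ) ^ (l + 1) * (‖h‖ / √ρ)) / ρ ^ l = K * √ρ := by
    rw [hK, div_eq_iff (by positivity), mul_pow _ ρ, pow_succ ρ]
    have : ρ * (‖h‖ / √ρ) = ‖h‖ * √ρ := by
      rw [mul_div_assoc', div_eq_iff hsq0.ne', mul_assoc, hsq, mul_comm]
    linear_combination (l.factorial * (4 * α) ^ (l + 1) * ρ ^ l) * this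
  rw [e]
  have : ρ ≤ t := by linarith
  gcongr

theorem HasNTLimit.add {f g : ℂ → ℂ} {ζ v w : ℂ} (hf : HasNTLimit f ζ v) (hg : HasNTLimit g ζ w) :
    HasNTLimit (fun z => f z + g z) ζ (v + w) := fun α hα => (hf α hα).add (hg α hα)

theorem HasNTLimit.congr {f g : ℂ → ℂ} {ζ w : ℂ} (hf : HasNTLimit f ζ w)
    (h : ∀ z ∈ disc, f z = g z) : HasNTLimit g ζ w := fun α hα =>
  (hf α hα).congr' (by filter_upwards [eventually_mem_disc ζ α] with z hz using h z hz)

theorem hasNTLimit_of_continuous {f : ℂ → ℂ} (hf : Continuous f) (ζ : ℂ) :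
    HasNTLimit f ζ (f ζ) := fun _ _ => hf.continuousAt.tendsto.mono_left nhdsWithin_le_nhds

theorem iteratedDeriv_polynomial (l : ℕ) (P : ℂ[X]) :
    iteratedDeriv l (fun z => P.eval z) = fun z => (derivative^[l] P).eval z := by
  induction l generalizing P with
  | zero => simp
  | succ l ih =>
    rw [iteratedDeriv_succ', Function.iterate_succ_apply, ← ih]
    congr 1
    ext z
    exact P.deriv

theorem hasNTLimit_iteratedDeriv {ζ : ℂ} (hζ : ‖ζ‖ = 1) {m l : ℕ} (hl : l < m) {v : ℂ → ℂ}
    {P : ℂ[X]} {h : EllTwo} (hv : ∀ z ∈ disc, v z = P.eval z + (z - ζ) ^ m * series h z) :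
    HasNTLimit (iteratedDeriv l v) ζ ((derivative^[l] P).eval ζ) := by
  have h1 := (hasNTLimit_of_continuous (derivative^[l] P).continuous ζ).add
    (hasNTLimit_iteratedDeriv_pow_mul_series hζ hl h)
  rw [add_zero] at h1
  refine h1.congr fun z hz => ?_
  have hn : disc ∈ 𝓝 z := isOpen_disc.mem_nhds hz
  have e : v =ᶠ[𝓝 z] fun z => P.eval z + (z - ζ) ^ m * series h z := by
    filter_upwards [hn] with w hw using hv w hw
  rw [e.iteratedDeriv_eq l, iteratedDeriv_fun_add, iteratedDeriv_polynomial]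
  · exact P.differentiable.contDiff.contDiffAt
  · exact ((differentiableOn_pow_mul_series ζ m h).contDiffOn isOpen_disc).contDiffAt hn

theorem hasNTLimit_div_pow {ζ : ℂ} (hζ : ‖ζ‖ = 1) {m k : ℕ} (hk : k < m) {v : ℂ → ℂ}
    {P : ℂ[X]} {h : EllTwo}
    (hv : ∀ z ∈ disc, v z = ((X - C ζ) ^ k * P).eval z + (z - ζ) ^ m * series h z) :
    HasNTLimit (fun z => v z / (z - ζ) ^ k) ζ (P.eval ζ) := by
  -- The derivative of order `0`, with the positive exponent `m - k`.
  have h1 := (hasNTLimit_of_continuous P.continuous ζ).add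
    (hasNTLimit_iteratedDeriv_pow_mul_series hζ (Nat.sub_pos_of_lt hk) h)
  rw [add_zero] at h1
  refine h1.congr fun z hz => ?_
  have h0 := pow_ne_zero k (ne_of_mem_disc hζ hz)
  rw [iteratedDeriv_zero, hv z hz, eq_div_iff h0]
  simp only [eval_mul, eval_pow, eval_sub, eval_X, eval_C]
  obtain ⟨j, rfl⟩ := Nat.exists_eq_add_of_lt hk
  rw [show k + j + 1 - k = j + 1 by lia]
  ring

/-- The quotient of `v` by `(z - ζ) ^ k` either converges or is at least of order
`(z - ζ)⁻¹`. -/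
theorem hasNTLimit_div_pow_or {ζ : ℂ} (hζ : ‖ζ‖ = 1) {m k : ℕ} (hk : k < m) {v : ℂ → ℂ}
    {P : ℂ[X]} {h : EllTwo} (hv : ∀ z ∈ disc, v z = P.eval z + (z - ζ) ^ m * series h z) :
    (∃ L, HasNTLimit (fun z => v z / (z - ζ) ^ k) ζ L) ∨
      ∀ α : ℝ, 1 < α → ∃ c > 0, ∀ᶠ z in 𝓝[stolz ζ α] ζ, c ≤ ‖v z / (z - ζ) ^ k‖ * ‖z - ζ‖ := by
  by_cases hdvd : (X - C ζ) ^ k ∣ P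
  · obtain ⟨Q, rfl⟩ := hdvd
    exact Or.inl ⟨_, hasNTLimit_div_pow hζ hk hv⟩
  right
  intro α hα
  have hP : P ≠ 0 := by
    rintro rfl
    exact hdvd (dvd_zero _)
  have hj : rootMultiplicity ζ P < k := by
    by_contra! hle
    exact hdvd ((le_rootMultiplicity_iff hP).1 hle)
  -- If `P` vanishes only to order `j < k`, then `v / (z - ζ)^j` has a nonzero limit and at least
  -- one factor `(z - ζ)⁻¹` remains.
  obtain ⟨Q, hQ, hQ'⟩ := exists_eq_pow_rootMultiplicity_mul_and_not_dvd P hP ζ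
  set j := rootMultiplicity ζ P
  have hQ0 : Q.eval ζ ≠ 0 := fun h0 => hQ' (dvd_iff_isRoot.2 h0)
  rw [hQ] at hv
  have hlim := (hasNTLimit_div_pow hζ (hj.trans hk) hv α hα).norm
  refine ⟨‖Q.eval ζ‖ / 2, by positivity, ?_⟩
  filter_upwards [eventually_mem_disc ζ α, hlim.eventually (lt_mem_nhds
    (half_lt_self (norm_pos_iff.2 hQ0))), (tendsto_norm_sub ζ (stolz ζ α)).eventually
    (gt_mem_nhds one_pos)] with z hz h1 h2
  refine h1.le.trans ?_
  have h0 : 0 < ‖z - ζ‖ := norm_pos_iff.2 (ne_of_mem_disc hζ hz)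
  obtain ⟨i, rfl⟩ := Nat.exists_eq_add_of_lt hj
  rw [norm_div, norm_div, norm_pow, norm_pow, div_mul_eq_mul_div, div_le_div_iff₀ (by positivity)
    (by positivity)]
  have h3 : ‖z - ζ‖ ^ (j + i + 1) = ‖z - ζ‖ ^ j * (‖z - ζ‖ ^ i * ‖z - ζ‖) := by ring
  have h4 : ‖z - ζ‖ ^ i ≤ 1 := pow_le_one₀ h0.le h2.le
  calc ‖v z‖ * ‖z - ζ‖ ^ (j + i + 1) = ‖v z‖ * ‖z - ζ‖ * ‖z - ζ‖ ^ j * ‖z - ζ‖ ^ i := by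
        rw [h3]; ring
    _ ≤ ‖v z‖ * ‖z - ζ‖ * ‖z - ζ‖ ^ j * 1 := by gcongr
    _ = _ := mul_one _

/-- A consequence of the Schwarz–Pick inequality. -/
theorem exists_mul_one_sub_norm_le {φ : ℂ → ℂ} (hφ : DifferentiableOn ℂ φ disc)
    (hφD : Set.MapsTo φ disc disc) :
    ∃ c > 0, ∀ z ∈ disc, c * (1 - ‖z‖) ≤ 1 - ‖φ z‖ := by
  set β := φ 0
  have hβ : ‖β‖ < 1 := mem_disc.1 (hφD (mem_disc.2 (by simp)))
  have hne : ∀ w ∈ disc, 1 - conj β * w ≠ 0 := fun w hw h0 => by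
    have h1 : ‖conj β * w‖ = 1 := by rw [← sub_eq_zero.1 h0, norm_one]
    rw [norm_mul, Complex.norm_conj] at h1
    nlinarith [mem_disc.1 hw, norm_nonneg w, norm_nonneg β]
  have key : ∀ w : ℂ, ‖1 - conj β * w‖ ^ 2 - ‖w - β‖ ^ 2 = (1 - ‖β‖ ^ 2) * (1 - ‖w‖ ^ 2) := by
    intro w
    simp only [← Complex.normSq_eq_norm_sq, Complex.normSq_apply, Complex.sub_re, Complex.sub_im,
      Complex.mul_re, Complex.mul_im, Complex.conj_re, Complex.conj_im, Complex.one_re,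
      Complex.one_im]
    ring
  have hβ2 : 0 < 1 - ‖β‖ ^ 2 := by nlinarith [norm_nonneg β]
  -- Composing with the disc automorphism that sends `φ 0` to `0` allows the Schwarz lemma `|ψ z| ≤
  -- |z|`; the identity `key` converts it into the claimed bound.
  set ψ : ℂ → ℂ := fun z => (φ z - β) / (1 - conj β * φ z)
  have hψd : DifferentiableOn ℂ ψ (Metric.ball 0 1) :=
    (hφ.sub_const β).div ((hφ.const_mul _).const_sub 1) fun z hz => hne _ (hφD hz)
  have hψ : Set.MapsTo ψ (Metric.ball 0 1) (Metric.closedBall 0 1) := by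
    intro z hz
    have hφz := mem_disc.1 (hφD hz)
    rw [mem_closedBall_zero_iff, norm_div, div_le_one (norm_pos_iff.2 (hne _ (hφD hz)))]
    refine abs_le_of_sq_le_sq' ?_ (norm_nonneg _) |>.2
    have h1 : 0 ≤ 1 - ‖φ z‖ ^ 2 := by nlinarith [norm_nonneg (φ z)]
    nlinarith [key (φ z), mul_nonneg hβ2.le h1]
  refine ⟨(1 - ‖β‖) ^ 2 / 2, by have : 0 < 1 - ‖β‖ := by linarith
                                positivity, fun z hz => ?_⟩
  have hz1 := mem_disc.1 hz
  have hφz := mem_disc.1 (hφD hz)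
  have h1 : ‖ψ z‖ ≤ ‖z‖ :=
    Complex.norm_le_norm_of_mapsTo_ball hψd hψ (by simp [ψ, β]) hz1
  have h2 : 0 < ‖1 - conj β * φ z‖ := norm_pos_iff.2 (hne _ (hφD hz))
  have h3 : ‖φ z - β‖ ≤ ‖z‖ * ‖1 - conj β * φ z‖ := by
    rw [norm_div, div_le_iff₀ h2] at h1
    exact h1
  have h4 : 1 - ‖β‖ ≤ ‖1 - conj β * φ z‖ := by
    have := norm_sub_norm_le 1 (conj β * φ z)
    rw [norm_one, norm_mul, Complex.norm_conj] at this
    nlinarith [norm_nonneg β]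
  have h5 : ‖φ z - β‖ ^ 2 ≤ ‖z‖ ^ 2 * ‖1 - conj β * φ z‖ ^ 2 := by
    rw [← mul_pow]
    gcongr
  have h6 : (1 - ‖z‖ ^ 2) * (1 - ‖β‖) ^ 2 ≤ (1 - ‖z‖ ^ 2) * ‖1 - conj β * φ z‖ ^ 2 := by
    have : 0 ≤ 1 - ‖z‖ ^ 2 := by nlinarith [norm_nonneg z]
    have : 0 ≤ 1 - ‖β‖ := by linarith
    gcongr
  have h7 : (1 - ‖z‖ ^ 2) * (1 - ‖β‖) ^ 2 ≤ (1 - ‖β‖ ^ 2) * (1 - ‖φ z‖ ^ 2) := by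
    nlinarith [key (φ z)]
  have h8 : (1 - ‖β‖ ^ 2) * (1 - ‖φ z‖ ^ 2) ≤ 1 * (2 * (1 - ‖φ z‖)) := by
    have : 0 ≤ 1 - ‖φ z‖ ^ 2 := by nlinarith [norm_nonneg (φ z)]
    gcongr
    · nlinarith [norm_nonneg β]
    · nlinarith [norm_nonneg (φ z)]
  have h9 : (1 - ‖z‖) * (1 - ‖β‖) ^ 2 ≤ (1 - ‖z‖ ^ 2) * (1 - ‖β‖) ^ 2 := by
    gcongr
    nlinarith [norm_nonneg z]
  linarith

end DBR

/-! ### Excluding bad boundary behaviour of the symbol -/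

namespace DBR

open Polynomial Filter Topology

/-- If `u / (z - ζ) ^ k` and `u f(φ) / (z - ζ) ^ k` behave like elements of `H(b)` at `ζ`, with a
nonzero limit for the former, then `f ∘ φ` is not unbounded along Stolz regions at `ζ`. -/
theorem not_tendsto_atTop_of_local_form {ζ A : ℂ} (hζ : ‖ζ‖ = 1) {m k : ℕ} (hk : k < m)
    {u φ : ℂ → ℂ} (hA : A ≠ 0) (hu : HasNTLimit (fun z => u z / (z - ζ) ^ k) ζ A)
    (hφ : DifferentiableOn ℂ φ disc) (hφD : Set.MapsTo φ disc disc) {c : EllTwo} {P : ℂ[X]}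
    {h : EllTwo}
    (hv : ∀ z ∈ disc, u z * series c (φ z) = P.eval z + (z - ζ) ^ m * series h z) :
    ¬ Tendsto (fun z => ‖series c (φ z)‖) (𝓝[stolz ζ 2] ζ) atTop := by
  intro htop
  have hne := neBot_nhdsWithin_stolz hζ one_lt_two
  have hU := (hu 2 one_lt_two).norm
  have hsplit : ∀ z, ‖u z * series c (φ z) / (z - ζ) ^ k‖
      = ‖u z / (z - ζ) ^ k‖ * ‖series c (φ z)‖ := fun z => by
    rw [← norm_mul, div_mul_eq_mul_div]
  rcases hasNTLimit_div_pow_or hζ hk hv with ⟨L, hL⟩ | hlow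
  · have h1 := (hL 2 one_lt_two).norm
    simp only [hsplit] at h1
    exact not_tendsto_nhds_of_tendsto_atTop (hU.pos_mul_atTop (norm_pos_iff.2 hA) htop) _ h1
  · obtain ⟨c₁, hc₁, hlow⟩ := hlow 2 one_lt_two
    obtain ⟨c₀, hc₀, hsp⟩ := exists_mul_one_sub_norm_le hφ hφD
    -- In the blow-up case, the quotient times `|z - ζ|` stays above `c₁ > 0`, yet is at most a
    -- bounded factor times `|z - ζ|^(1/2)`.
    have h1 : Tendsto (fun z => ‖u z / (z - ζ) ^ k‖ * (‖c‖ / √(c₀ / 2) * √‖z - ζ‖))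
        (𝓝[stolz ζ 2] ζ) (𝓝 0) := by
      have h2 := ((Real.continuous_sqrt.tendsto 0).comp
        (tendsto_norm_sub ζ (stolz ζ 2))).const_mul (‖c‖ / √(c₀ / 2))
      have h3 := hU.mul h2
      rwa [Real.sqrt_zero, mul_zero, mul_zero] at h3
    refine absurd (ge_of_tendsto h1 ?_) (not_le.2 hc₁)
    filter_upwards [hlow, self_mem_nhdsWithin] with z hz hzs
    refine hz.trans ?_
    rw [hsplit, mul_assoc]
    have hzd : z ∈ disc := mem_disc.2 hzs.1
    have ht : 0 < ‖z - ζ‖ := norm_pos_iff.2 (ne_of_mem_disc hζ hzd)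
    have hsq : √‖z - ζ‖ * √‖z - ζ‖ = ‖z - ζ‖ := Real.mul_self_sqrt ht.le
    -- The `2` is the aperture: `|z - ζ| < 2 (1 - |z|)`.
    have hle : c₀ / 2 * ‖z - ζ‖ ≤ 1 - ‖φ z‖ := by
      have := hsp z hzd
      nlinarith [hzs.2]
    have h4 : ‖series c (φ z)‖ ≤ ‖c‖ / (√(c₀ / 2) * √‖z - ζ‖) := by
      refine (norm_series_le c (mem_disc.1 (hφD hzd))).trans ?_
      rw [← Real.sqrt_mul (by positivity)]
      gcongr
    have hq : 0 < √‖z - ζ‖ := Real.sqrt_pos.2 ht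
    have hq' : 0 < √(c₀ / 2) := Real.sqrt_pos.2 (by positivity)
    have h5 : ‖series c (φ z)‖ * ‖z - ζ‖ ≤ ‖c‖ / √(c₀ / 2) * √‖z - ζ‖ := by
      calc ‖series c (φ z)‖ * ‖z - ζ‖ ≤ ‖c‖ / (√(c₀ / 2) * √‖z - ζ‖) * ‖z - ζ‖ := by gcongr
        _ = ‖c‖ / (√(c₀ / 2) * √‖z - ζ‖) * (√‖z - ζ‖ * √‖z - ζ‖) := by rw [hsq]
        _ = _ := by field_simp
    gcongr

/-- If the quotient of `u φ` converges, dividing by that of `u` gives the limit of `φ`. Otherwise it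
would be of order at least `|z - ζ|⁻¹`, impossible since `|φ| < 1` and the quotient of `u`
converges. -/
theorem exists_hasNTLimit_of_local_form {ζ A : ℂ} (hζ : ‖ζ‖ = 1) {m k : ℕ} (hk : k < m)
    {u φ : ℂ → ℂ} (hA : A ≠ 0) (hu : HasNTLimit (fun z => u z / (z - ζ) ^ k) ζ A)
    (hφD : Set.MapsTo φ disc disc) {P : ℂ[X]} {h : EllTwo}
    (hv : ∀ z ∈ disc, u z * φ z = P.eval z + (z - ζ) ^ m * series h z) :
    ∃ w, HasNTLimit φ ζ w := by
  have hne := neBot_nhdsWithin_stolz hζ one_lt_two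
  rcases hasNTLimit_div_pow_or hζ hk hv with ⟨L, hL⟩ | hlow
  · refine ⟨L / A, fun α hα => ((hL α hα).div (hu α hα) hA).congr' ?_⟩
    filter_upwards [(hu α hα).eventually_ne hA] with z hz
    rw [Pi.div_apply, mul_div_right_comm, mul_div_cancel_left₀ _ hz]
  · obtain ⟨c, hc, hlow⟩ := hlow 2 one_lt_two
    have h1 := (hu 2 one_lt_two).norm.mul (tendsto_norm_sub ζ (stolz ζ 2))
    rw [mul_zero] at h1
    refine absurd (ge_of_tendsto h1 ?_) (not_le.2 hc)
    filter_upwards [hlow, eventually_mem_disc ζ 2] with z hz hzd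
    refine hz.trans ?_
    gcongr
    rw [mul_div_right_comm, norm_mul]
    exact mul_le_of_le_one_right (norm_nonneg _) (mem_disc.1 (hφD hzd)).le

end DBR

theorem theorem4p1 (b a : RatFunc ℂ) (hb : DBR.IsSymbol b) (ha : DBR.IsPythagoreanMate b a)
    (u φ : ℂ → ℂ) (hu : DifferentiableOn ℂ u DBR.disc) (hφ : DifferentiableOn ℂ φ DBR.disc)
    (hφD : Set.MapsTo φ DBR.disc DBR.disc) (hW : DBR.IsBoundedWComp b u φ) :
    ∀ ζ ∈ DBR.circleZeros a, ∃ c : ℕ → ℂ,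
      (∀ ℓ < DBR.zeroMult a ζ, DBR.HasNTLimit (iteratedDeriv ℓ u) ζ (c ℓ)) ∧
      ((∃ ℓ < DBR.zeroMult a ζ, c ℓ ≠ 0) →
        ∃ w : ℂ, DBR.HasNTLimit φ ζ w ∧ w ∈ DBR.disc ∪ DBR.circleZeros a) := by
  open DBR Polynomial Filter Topology in
  intro ζ hζa
  have hζ : ‖ζ‖ = 1 := hζa.1
  obtain ⟨_, hW⟩ := hW
  obtain ⟨P, h, hP⟩ := exists_local_form hb.noPoles ha
    (hW _ (one_mem_dbrSpace hb.noPoles ha)).1 hζ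
  simp only [weightedComp, mul_one] at hP
  refine ⟨fun ℓ => (derivative^[ℓ] P).eval ζ,
    fun ℓ hℓ => hasNTLimit_iteratedDeriv hζ hℓ hP, ?_⟩
  rintro ⟨ℓ, hℓ, hne⟩
  have hP0 : P ≠ 0 := by
    rintro rfl
    simp at hne
  -- The order of vanishing of `P` serves as `k`; were it at least the multiplicity of `ζ`, all the
  -- limits in question would be `0`.
  have hk : rootMultiplicity ζ P < zeroMult a ζ := by
    by_contra! hle
    exact hne (isRoot_iterate_derivative_of_lt_rootMultiplicity (hℓ.trans_le hle))
  obtain ⟨Q, hQ, hQ'⟩ := exists_eq_pow_rootMultiplicity_mul_and_not_dvd P hP0 ζ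
  have hQ0 : Q.eval ζ ≠ 0 := fun h0 => hQ' (dvd_iff_isRoot.2 h0)
  have hU := hasNTLimit_div_pow hζ hk (v := u) (P := Q) (h := h) (by rwa [← hQ])
  obtain ⟨P₁, h₁, hP₁⟩ := exists_local_form hb.noPoles ha
    (hW _ (id_mem_dbrSpace hb.noPoles ha)).1 hζ
  obtain ⟨w, hw⟩ := exists_hasNTLimit_of_local_form hζ hk hQ0 hU hφD hP₁
  refine ⟨w, hw, ?_⟩
  have hne2 := neBot_nhdsWithin_stolz hζ one_lt_two
  have hw1 : ‖w‖ ≤ 1 := le_of_tendsto (hw 2 one_lt_two).norm (by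
    filter_upwards [eventually_mem_disc ζ 2] with z hz using (mem_disc.1 (hφD hz)).le)
  rcases hw1.lt_or_eq with hlt | heq
  · exact Or.inl (mem_disc.2 hlt)
  · right
    by_contra hwa
    obtain ⟨c, hc, htop⟩ := exists_mem_dbrSpace_tendsto_atTop hb.noPoles ha heq hwa
    obtain ⟨P₂, h₂, hP₂⟩ := exists_local_form hb.noPoles ha (hW _ hc).1 hζ
    refine not_tendsto_atTop_of_local_form hζ hk hQ0 hU hφ hφD hP₂ (htop.comp ?_)
    refine tendsto_nhdsWithin_iff.2 ⟨hw 2 one_lt_two, ?_⟩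
    filter_upwards [eventually_mem_disc ζ 2] with z hz using hφD hz
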